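/- Let $i,j\ge 1$ and $M\ge 2$ be integers. Let $E$ be a set of $i+j+2$ labels, written $E=\{s_0,\dots,s_j\}\sqcup\{t_0,\dots,t_i\}$. Doliwa's configuration with Coxeter symbol $0_{i,j}$ is the incidence structure whose points (vertices of the $0_{i,j}$-polytope) are the $(j+1)$-subsets $S$ of $E$ and whose lines ($0_{i,0}$-facets) are the $j$-subsets $L$ of $E$, with $S$ on $L$ iff $L\subset S$. A realisation of it in $\mathbb A^M$ over a field $K$ assigns to each $S$ a point $x_S\in K^M$ and to each $L$ an affine line $\ell_L\subset K^M$ such that $x_S\in\ell_L$ whenever $L\subset S$; it is faithful if distinct $S$ have distinct $x_S$, distinct $L$ have distinct $\ell_L$, and $x_S\in\ell_L$ only if $L\subset S$. A combinatorial symmetry is an automorphism of the incidence structure, that is, a pair of permutations of its points and of its lines preserving and reflecting incidence. Let $S_0=\{s_0,\dots,s_j\}$ and $S_{mn}=(S_0\setminus\{s_n\})\cup\{t_m\}$ for $0\le m\le i$, $0\le n\le j$. Freely choose a point $y_0\in\mathbb A^M$, $j+1$ lines through it with directions $d_0,\dots,d_j$, and $i+1$ additional points $y_{mn}=y_0+c_{mn}d_n$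 on the $n$-th line. "In general position" means that a certain polynomial $P$ does not vanish at the parameters $(y_0,d_n,c_{mn})$; here $P$ has integer coefficients, depends only on $i,j,M$, and is non-zero over every field. The generators (the case $k=0$ of Coble's group) act on arrays $(y_0,(y_{mn}))$ of elements of $K$ as follows: $t_m$ ($1\le m\le i$) exchanges $y_{(m-1)n}\leftrightarrow y_{mn}$ for all $n$; $s_n$ ($1\le n\le j$) exchanges $y_{m(n-1)}\leftrightarrow y_{mn}$ for all $m$; and $r_0$ exchanges $y_0\leftrightarrow y_{00}$, fixes $y_{m0}$ and $y_{0n}$ for $m,n\ge1$, and replaces $y_{mn}$ for $m,n\ge 1$ by the element $\bar y_{mn}$ determined uniquely by $$\frac{(y_0-y_{m0})(y_{0n}-y_{mn})(y_{00}-\bar y_{mn})}{(y_0-y_{mn})(y_{00}-y_{m0})(y_{0n}-\bar y_{mn})}=1 .$$ They act on arrays of points of $\mathbb A^M$ diagonally, i.e. separately in each coordinate. To $t_m$, $s_n$, $r_0$ associate the combinatorial symmetries induced by the transpositions $(t_{m-1}\,t_m)$, $(s_{n-1}\,s_n)$, $(s_0\,t_0)$ of $E$, and to a word $w=g_1g_2\cdots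 g_r$ in the generators the product $\varphi_w$ of the associated symmetries. Then every combinatorial symmetry of the configuration is of the form $\varphi_w$, and there is a polynomial $P$ as above such that for every field $K$ and every choice of $y_0,d_n,c_{mn}$ over $K$ in general position: 1. (Determining set.) There is a faithful realisation $(x,\ell)$ of the configuration in $\mathbb A^M$ with $x_{S_0}=y_0$ and $x_{S_{mn}}=y_{mn}$ for all $m,n$. In it the line $\ell_{S_0\setminus\{s_n\}}$ is the $n$-th chosen line. It is the only realisation, faithful or not, with these values at $S_0$ and $S_{mn}$. 2. (Symmetries.) For every word $w=g_1\cdots g_r$, applying successively the diagonal transformations $g_1,\dots,g_r$ to $(y_0,(y_{mn}))$ is defined at each step and gives the image of the determining set under $\varphi_w$, that is, the array $(x_{\varphi_w(S_0)},(x_{\varphi_w(S_{mn})}))$. -/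

import Mathlib

/-- The `i + j + 2` labels permuted by the symmetry group of the `0_{i,j}`-polytope, split as
`j + 1` labels `inl n` and `i + 1` labels `inr m`. -/
abbrev Label (i j : ℕ) : Type := Fin (j + 1) ⊕ Fin (i + 1)

/-- Vertices of the `0_{i,j}`-polytope, which is a rectified simplex of dimension `i + j + 1`:
the `(j + 1)`-element subsets of the `i + j + 2` labels. -/
abbrev Vertex (i j : ℕ) : Type := {S : Finset (Label i j) // S.card = j + 1}

/-- The `0_{i,0}`-facets of the `0_{i,j}`-polytope. They are simplexes with `i + 2` vertices, and
are indexed by the `j`-element subsets `L` of the labels: the vertices of the facet `L` are the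
`(j + 1)`-element sets containing `L`. Each vertex lies on `j + 1` of them. -/
abbrev Facet (i j : ℕ) : Type := {L : Finset (Label i j) // L.card = j}

/-- Incidence of a vertex and a `0_{i,0}`-facet. -/
def Incident {i j : ℕ} (S : Vertex i j) (L : Facet i j) : Prop := L.1 ⊆ S.1

/-- A combinatorial symmetry: an automorphism of the incidence structure of vertices and
`0_{i,0}`-facets. -/
@[ext]
structure Symmetry (i j : ℕ) where
  onVertex : Equiv.Perm (Vertex i j)
  onFacet : Equiv.Perm (Facet i j)
  incident_iff : ∀ S L, Incident (onVertex S) (onFacet L) ↔ Incident S L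

/-- The permutation of the `k`-element subsets induced by a permutation of the labels. -/
def permSubsets {α : Type*} (σ : Equiv.Perm α) (k : ℕ) :
    Equiv.Perm {S : Finset α // S.card = k} where
  toFun S := ⟨S.1.map σ.toEmbedding, by rw [Finset.card_map]; exact S.2⟩
  invFun S := ⟨S.1.map σ.symm.toEmbedding, by rw [Finset.card_map]; exact S.2⟩
  left_inv S := by
    apply Subtype.ext
    ext x
    simp
  right_inv S := by
    apply Subtype.ext
    ext x
    simp

/-- The combinatorial symmetry induced by a permutation of the labels. -/
def Symmetry.ofPerm {i j : ℕ} (σ : Equiv.Perm (Label i j)) : Symmetry i j where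
  onVertex := permSubsets σ (j + 1)
  onFacet := permSubsets σ j
  incident_iff S L := by
    simp only [Incident, permSubsets, Equiv.coe_fn_mk]
    exact Finset.map_subset_map

/-- The vertex occupied by `y_0`: the set of all labels `inl n`. -/
def baseVertex (i j : ℕ) : Vertex i j :=
  ⟨Finset.univ.map Function.Embedding.inl, by simp⟩

/-- The `n`-th of the `j + 1` facets through `baseVertex`. -/
def baseFacet (i : ℕ) {j : ℕ} (n : Fin (j + 1)) : Facet i j :=
  ⟨(Finset.univ.erase n).map Function.Embedding.inl, by simp⟩

/-- The vertex occupied by `y_{mn}`: in the label set of `baseVertex`, replace `inl n` by `inr m`.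
For fixed `n` these are the `i + 1` vertices of `baseFacet i n` other than `baseVertex i j`. -/
def arrayVertex {i j : ℕ} (m : Fin (i + 1)) (n : Fin (j + 1)) : Vertex i j :=
  ⟨insert (Sum.inr m) (baseFacet i n).1, by
    rw [Finset.card_insert_of_notMem (by simp [baseFacet]), (baseFacet i n).2]⟩

/-- A line of an affine space: a non-empty affine subspace of dimension one. -/
def IsAffineLine {K V : Type*} [Field K] [AddCommGroup V] [Module K V]
    (l : AffineSubspace K V) : Prop :=
  (l : Set V).Nonempty ∧ Module.finrank K l.direction = 1

/-- A (possibly degenerate) point-line realisation in affine `M`-space of the incidence structure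
of vertices and `0_{i,0}`-facets of the `0_{i,j}`-polytope: incident pairs are sent to incident
pairs, but distinct vertices or facets may coincide and there may be further incidences. -/
@[ext]
structure Realisation (K : Type*) [Field K] (i j M : ℕ) where
  point : Vertex i j → (Fin M → K)
  line : Facet i j → AffineSubspace K (Fin M → K)
  isAffineLine : ∀ L, IsAffineLine (line L)
  mem_of_incident : ∀ S L, Incident S L → point S ∈ line L

/-- A realisation is faithful if distinct vertices give distinct points, distinct facets give
distinct lines, and a point lies on a line only when the incidence structure demands it. -/
structure Realisation.IsFaithful {K : Type*} [Field K] {i j M : ℕ}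
    (R : Realisation K i j M) : Prop where
  point_injective : Function.Injective R.point
  line_injective : Function.Injective R.line
  mem_iff : ∀ S L, R.point S ∈ R.line L ↔ Incident S L

/-- A pair of arrays of shape `[y_0]` and `[y_{mn}]`, `m = 0, …, i`, `n = 0, …, j`. -/
structure PairArray (X : Type*) (i j : ℕ) where
  y0 : X
  y : Fin (i + 1) → Fin (j + 1) → X

/-- Coordinate `a` of a pair of arrays of points. -/
def PairArray.coord {K : Type*} {i j M : ℕ} (Y : PairArray (Fin M → K) i j) (a : Fin M) :
    PairArray K i j where
  y0 := Y.y0 a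
  y m n := Y.y m n a

/-- The free parameters of the initial choice of points and lines. -/
inductive DataVar (i j M : ℕ) : Type
  /-- the coordinates of the first point -/
  | base (a : Fin M)
  /-- the coordinates of a direction vector of the `n`-th line -/
  | dir (n : Fin (j + 1)) (a : Fin M)
  /-- the position of the `m`-th additional point on the `n`-th line -/
  | coef (m : Fin (i + 1)) (n : Fin (j + 1))

/-- The freely chosen points: a point `y_0`, and, on the line through `y_0` with the `n`-th
direction vector `d_n`, the points `y_{mn} = y_0 + c_{mn} d_n`. -/
def initialPoints {K : Type*} [Field K] {i j M : ℕ} (θ : DataVar i j M → K) :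
    PairArray (Fin M → K) i j where
  y0 := fun a => θ (.base a)
  y m n := fun a => θ (.base a) + θ (.coef m n) * θ (.dir n a)

/-- The freely chosen lines through `y_0`. -/
def initialLine {K : Type*} [Field K] {i j M : ℕ} (θ : DataVar i j M → K) (n : Fin (j + 1)) :
    AffineSubspace K (Fin M → K) :=
  AffineSubspace.mk' (initialPoints θ).y0 (Submodule.span K {fun a => θ (.dir n a)})

/-- The image, in a realisation, of the vertices `y_0`, `y_{mn}` under a combinatorial symmetry. -/
def Realisation.image {K : Type*} [Field K] {i j M : ℕ} (R : Realisation K i j M)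
    (φ : Symmetry i j) : PairArray (Fin M → K) i j where
  y0 := R.point (φ.onVertex (baseVertex i j))
  y m n := R.point (φ.onVertex (arrayVertex m n))

/-- The realisation has the freely chosen points as its vertices `y_0`, `y_{mn}`. -/
def Realisation.Extends {K : Type*} [Field K] {i j M : ℕ} (R : Realisation K i j M)
    (θ : DataVar i j M → K) : Prop :=
  R.point (baseVertex i j) = (initialPoints θ).y0 ∧
    ∀ m n, R.point (arrayVertex m n) = (initialPoints θ).y m n

/-- The generators `t_1, …, t_i`, `s_1, …, s_j`, `r_0` of the group in the case `k = 0`;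
`t m` and `s n` here are `t_{m+1}` and `s_{n+1}`. -/
inductive Gen (i j : ℕ) : Type
  | t (m : Fin i)
  | s (n : Fin j)
  | r0

/-- The permutation of the labels corresponding to a generator. -/
def Gen.perm {i j : ℕ} : Gen i j → Equiv.Perm (Label i j)
  | .t m => Equiv.swap (Sum.inr m.castSucc) (Sum.inr m.succ)
  | .s n => Equiv.swap (Sum.inl n.castSucc) (Sum.inl n.succ)
  | .r0 => Equiv.swap (Sum.inl 0) (Sum.inr 0)

/-- The combinatorial symmetry corresponding to a word in the generators. -/
def wordSymmetry {i j : ℕ} (w : List (Gen i j)) : Symmetry i j :=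
  Symmetry.ofPerm (w.map Gen.perm).prod

/-- The six-point multi-ratio. The value of the quotient is only ever compared with `1`, so that
the convention `x / 0 = 0` never makes the resulting equation hold. -/
def multiRatio {K : Type*} [Field K] (y0 ym0 y0n ymn y00 z : K) : K :=
  ((y0 - ym0) * (y0n - ymn) * (y00 - z)) / ((y0 - ymn) * (y00 - ym0) * (y0n - z))

/-- `g.Acts Y Y'`: the action of the generator `g` is defined at the pair of arrays `Y`, and gives
`Y'`. For `r_0` this includes that each entry `y_{mn}`, `m, n ≥ 1`, of `Y'` is the unique solution
of the six-point multi-ratio equation. -/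
def Gen.Acts {K : Type*} [Field K] {i j : ℕ} : Gen i j → PairArray K i j → PairArray K i j → Prop
  | .t m, Y, Y' =>
      Y'.y0 = Y.y0 ∧ ∀ p n, Y'.y p n = Y.y (Equiv.swap m.castSucc m.succ p) n
  | .s n, Y, Y' =>
      Y'.y0 = Y.y0 ∧ ∀ m q, Y'.y m q = Y.y m (Equiv.swap n.castSucc n.succ q)
  | .r0, Y, Y' =>
      Y'.y0 = Y.y 0 0 ∧ Y'.y 0 0 = Y.y0 ∧
      (∀ m, m ≠ 0 → Y'.y m 0 = Y.y m 0) ∧ (∀ n, n ≠ 0 → Y'.y 0 n = Y.y 0 n) ∧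
      ∀ m n, m ≠ 0 → n ≠ 0 → ∀ z,
        multiRatio Y.y0 (Y.y m 0) (Y.y 0 n) (Y.y m n) (Y.y 0 0) z = 1 ↔ z = Y'.y m n

/-- The diagonal (coordinatewise) action of a word `g_1 g_2 ⋯ g_r` in the generators on pairs of
arrays of points: the action is defined at `Y`, and gives `Y'`. Generators act on arrays of
variables by substitution, so on values the transformation `g_1` comes first. -/
def DiagonalActs {K : Type*} [Field K] {i j M : ℕ} :
    List (Gen i j) → PairArray (Fin M → K) i j → PairArray (Fin M → K) i j → Prop
  | [], Y, Y' => Y' = Y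
  | g :: w, Y, Y' => ∃ Z : PairArray (Fin M → K) i j,
      (∀ a, g.Acts (Y.coord a) (Z.coord a)) ∧ DiagonalActs w Z Y'

/-! The configuration is the projection of a hyperplane arrangement. In K^(j+1) attach to `inl n`
the n-th coordinate hyperplane and to `inr m` the hyperplane cutting the n-th axis at c_mn. In
general position any j+1 of these meet in a point (a vertex) and any j in a line (a facet). The base
vertex is the origin and the array vertices are the points c_mn e_n, so the affine map 0 ↦ y_0, e_n
↦ d_n carries the arrangement to a realisation with the prescribed data.

General position means that certain determinants, differences of coordinates and 2×2 minors, all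
integer polynomials in the parameters, do not vanish. None of them is the zero polynomial over any
field: at c_mn = r(inr m) - r(inl n), with r injective into an algebraic closure, incidence of a
point with a hyperplane becomes a root of a polynomial of degree at most j+1, and counting roots
excludes every unwanted incidence (`planeCoeff_dotProduct_vertexNum_witness_ne`).

Uniqueness is propagation (`config_maps_agree`): by induction on the number of `inr` labels, a line
is fixed by two known points and a point by two known lines. Applied with the configuration itself
as target, the same argument shows that every combinatorial symmetry comes from a permutation of the
labels, hence from a word in adjacent transpositions.

The arrangement treats all labels alike, so the action of a generator has to be checked only on
relabelled arrays. The case of `r0` is Menelaus' theorem for four lines in a plane, cut out by four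
hyperplanes inside the intersection of j-1 others; affine projection to a coordinate preserves it
(`IsGeneral.multiRatio_eq_one_iff`). -/

theorem Gen.exists_prod_perm {i j : ℕ} (σ : Equiv.Perm (Label i j)) :
    ∃ w : List (Gen i j), (w.map Gen.perm).prod = σ := by
  set H : Submonoid (Equiv.Perm (Label i j)) := Submonoid.closure (Set.range Gen.perm) with hH
  have mem (g : Gen i j) : g.perm ∈ H := Submonoid.subset_closure ⟨g, rfl⟩
  -- The transpositions with `inl 0` suffice: `s` carries them along the `inl` chain, `r0` crosses
  -- to `inr 0`, and `t` continues along the `inr` chain.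
  have left (n : Fin (j + 1)) : Equiv.swap (Sum.inl 0 : Label i j) (Sum.inl n) ∈ H := by
    induction n using Fin.induction with
    | zero => simp only [Equiv.swap_self]; exact H.one_mem
    | succ n ih => exact SubmonoidClass.swap_mem_trans H ih (mem (.s n))
  have right (m : Fin (i + 1)) : Equiv.swap (Sum.inl 0 : Label i j) (Sum.inr m) ∈ H := by
    induction m using Fin.induction with
    | zero => exact mem .r0
    | succ m ih => exact SubmonoidClass.swap_mem_trans H ih (mem (.t m))
  have all (x : Label i j) : Equiv.swap (Sum.inl 0 : Label i j) x ∈ H := by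
    rcases x with n | m
    · exact left n
    · exact right m
  have top : H = ⊤ := by
    rw [eq_top_iff, ← Equiv.Perm.mclosure_isSwap, Submonoid.closure_le]
    rintro _ ⟨x, y, -, rfl⟩
    exact SubmonoidClass.swap_mem_trans H (by rw [Equiv.swap_comm]; exact all x) (all y)
  obtain ⟨l, hl, rfl⟩ := Submonoid.exists_list_of_mem_closure (hH ▸ top ▸ Submonoid.mem_top σ)
  clear hH top all left right mem H
  induction l with
  | nil => exact ⟨[], rfl⟩
  | cons g l ih =>
    obtain ⟨w, hw⟩ := ih fun y hy => hl y (List.mem_cons_of_mem _ hy)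
    obtain ⟨a, ha⟩ := hl g List.mem_cons_self
    exact ⟨a :: w, by simp [hw, ha]⟩

/-! ### Combinatorics of vertices and facets -/

section Incidence

variable {i j : ℕ}

theorem mem_baseVertex {e : Label i j} : e ∈ (baseVertex i j).1 ↔ ∃ n, e = Sum.inl n := by
  simp [baseVertex, eq_comm]

theorem mem_baseFacet {n : Fin (j + 1)} {e : Label i j} :
    e ∈ (baseFacet i n).1 ↔ ∃ q, q ≠ n ∧ e = Sum.inl q := by
  simp only [baseFacet, Finset.mem_map, Finset.mem_erase, Finset.mem_univ, and_true,
    Function.Embedding.inl_apply, eq_comm]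

theorem mem_arrayVertex {m : Fin (i + 1)} {n : Fin (j + 1)} {e : Label i j} :
    e ∈ (arrayVertex m n).1 ↔ e = Sum.inr m ∨ ∃ q, q ≠ n ∧ e = Sum.inl q := by
  simp only [arrayVertex, Finset.mem_insert, mem_baseFacet]

theorem incident_baseVertex (n : Fin (j + 1)) : Incident (baseVertex i j) (baseFacet i n) := by
  intro e he
  obtain ⟨q, -, rfl⟩ := mem_baseFacet.1 he
  exact mem_baseVertex.2 ⟨q, rfl⟩

theorem incident_arrayVertex (m : Fin (i + 1)) (n : Fin (j + 1)) :
    Incident (arrayVertex m n) (baseFacet i n) :=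
  Finset.subset_insert _ _

theorem baseVertex_ne_arrayVertex (m : Fin (i + 1)) (n : Fin (j + 1)) :
    baseVertex i j ≠ arrayVertex m n := by
  intro h
  have : (Sum.inr m : Label i j) ∈ (baseVertex i j).1 := by
    rw [h]; exact mem_arrayVertex.2 (.inl rfl)
  simp [mem_baseVertex] at this

/-- The vertex obtained from a facet by adding a label. -/
def Facet.addLabel (L : Facet i j) (e : Label i j) (he : e ∉ L.1) : Vertex i j :=
  ⟨insert e L.1, by rw [Finset.card_insert_of_notMem he, L.2]⟩

theorem Facet.incident_addLabel (L : Facet i j) (e : Label i j) (he : e ∉ L.1) :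
    Incident (L.addLabel e he) L :=
  Finset.subset_insert _ _

theorem Facet.addLabel_injective (L : Facet i j) {e f : Label i j} (he : e ∉ L.1) (hf : f ∉ L.1)
    (h : L.addLabel e he = L.addLabel f hf) : e = f := by
  have : e ∈ insert f L.1 := by
    rw [← show insert e L.1 = insert f L.1 from congrArg Subtype.val h]
    exact Finset.mem_insert_self _ _
  exact (Finset.mem_insert.1 this).resolve_right he

/-- The facet obtained from a vertex by removing a label. -/
def Vertex.removeLabel (S : Vertex i j) (e : Label i j) (he : e ∈ S.1) : Facet i j :=
  ⟨S.1.erase e, by rw [Finset.card_erase_of_mem he, S.2]; rfl⟩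

theorem Vertex.incident_removeLabel (S : Vertex i j) (e : Label i j) (he : e ∈ S.1) :
    Incident S (S.removeLabel e he) :=
  Finset.erase_subset _ _

theorem Vertex.removeLabel_injective (S : Vertex i j) {e f : Label i j} (he : e ∈ S.1)
    (hf : f ∈ S.1) (h : S.removeLabel e he = S.removeLabel f hf) : e = f := by
  by_contra hne
  have : e ∈ S.1.erase e := by
    rw [show S.1.erase e = S.1.erase f from congrArg Subtype.val h]
    exact Finset.mem_erase.2 ⟨hne, he⟩
  simp at this

theorem Incident.exists_addLabel {S : Vertex i j} {L : Facet i j} (h : Incident S L) :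
    ∃ e, ∃ he : e ∉ L.1, S = L.addLabel e he := by
  obtain ⟨e, he⟩ : (S.1 \ L.1).Nonempty := by
    rw [← Finset.card_pos, Finset.card_sdiff_of_subset h, S.2, L.2]
    omega
  rw [Finset.mem_sdiff] at he
  refine ⟨e, he.2, Subtype.ext (Eq.symm (Finset.eq_of_subset_of_card_le ?_ ?_))⟩
  · exact Finset.insert_subset he.1 h
  · rw [S.2]; exact (L.addLabel e he.2).2.ge

theorem Incident.exists_removeLabel {S : Vertex i j} {L : Facet i j} (h : Incident S L) :
    ∃ e, ∃ he : e ∈ S.1, L = S.removeLabel e he ∧ e ∉ L.1 := by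
  obtain ⟨e, he, rfl⟩ := h.exists_addLabel
  exact ⟨e, Finset.mem_insert_self _ _, Subtype.ext (Finset.erase_insert he).symm, he⟩

/-- Two distinct vertices lie on at most one common facet. -/
theorem Incident.facet_unique {S T : Vertex i j} {L L' : Facet i j} (hST : S ≠ T)
    (hS : Incident S L) (hT : Incident T L) (hS' : Incident S L') (hT' : Incident T L') :
    L = L' := by
  have key : ∀ L : Facet i j, Incident S L → Incident T L → L.1 = S.1 ∩ T.1 := by
    intro L hS hT
    refine Finset.eq_of_subset_of_card_le (Finset.subset_inter hS hT) ?_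
    rw [L.2]
    by_contra! hlt
    have h1 : S.1 ∩ T.1 = S.1 :=
      Finset.eq_of_subset_of_card_le Finset.inter_subset_left (by rw [S.2]; omega)
    have h2 : S.1 ∩ T.1 = T.1 :=
      Finset.eq_of_subset_of_card_le Finset.inter_subset_right (by rw [T.2]; omega)
    exact hST (Subtype.ext (h1.symm.trans h2))
  exact Subtype.ext ((key L hS hT).trans (key L' hS' hT').symm)

theorem eq_baseVertex_of_toRight_card {S : Vertex i j} (h : S.1.toRight.card = 0) :
    S = baseVertex i j := by
  refine Subtype.ext (Finset.eq_of_subset_of_card_le ?_ ?_)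
  · rintro (n | m) he
    · exact mem_baseVertex.2 ⟨n, rfl⟩
    · rw [Finset.card_eq_zero] at h
      exact absurd (Finset.mem_toRight.2 he) (by simp [h])
  · rw [S.2, (baseVertex i j).2]

theorem eq_arrayVertex_of_toRight_card {S : Vertex i j} (h : S.1.toRight.card = 1) :
    ∃ m n, S = arrayVertex m n := by
  have hl : S.1.toLeftᶜ.card = 1 := by
    have h1 := S.1.card_toLeft_add_card_toRight
    have h2 := Finset.card_add_card_compl S.1.toLeft
    rw [Fintype.card_fin] at h2
    have := S.2
    omega
  obtain ⟨m, hm⟩ := Finset.card_eq_one.1 h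
  obtain ⟨n, hn⟩ := Finset.card_eq_one.1 hl
  refine ⟨m, n, Subtype.ext (Finset.ext ?_)⟩
  rintro (q | p)
  · rw [← Finset.mem_toLeft, ← compl_compl S.1.toLeft, hn, mem_arrayVertex]
    simp
  · rw [← Finset.mem_toRight, hm, mem_arrayVertex]
    simp

/-- Two maps of the configuration to a partial linear space that agree at the vertices `y_0` and
`y_{mn}` are equal if one of them is injective. -/
theorem config_maps_agree {X Y : Type*} (I : X → Y → Prop)
    (hI : ∀ p q l l', p ≠ q → I p l → I q l → I p l' → I q l' → l = l')
    {x x' : Vertex i j → X} {l l' : Facet i j → Y}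
    (hx : Function.Injective x) (hl : Function.Injective l)
    (h : ∀ S L, Incident S L → I (x S) (l L)) (h' : ∀ S L, Incident S L → I (x' S) (l' L))
    (hbase : x' (baseVertex i j) = x (baseVertex i j))
    (harray : ∀ m n, x' (arrayVertex m n) = x (arrayVertex m n)) :
    x' = x ∧ l' = l := by
  have line : ∀ L S T, S ≠ T → Incident S L → Incident T L → x' S = x S → x' T = x T →
      l' L = l L := fun L S T hne hS hT eS eT =>
    hI _ _ _ _ (hx.ne hne) (eS ▸ h' S L hS) (eT ▸ h' T L hT) (h S L hS) (h T L hT)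
  have lines : ∀ k, 1 ≤ k → (∀ S : Vertex i j, S.1.toRight.card ≤ k → x' S = x S) →
      ∀ L : Facet i j, L.1.toRight.card ≤ k → l' L = l L := by
    intro k hk hpt L hL
    have hcl := L.1.card_toLeft_add_card_toRight
    have hcc := Finset.card_add_card_compl L.1.toLeft
    rw [Fintype.card_fin] at hcc
    have hLc := L.2
    have cardl : ∀ n, ∀ hn : Sum.inl n ∉ L.1, (L.addLabel _ hn).1.toRight.card ≤ k := by
      intro n hn
      simpa [Facet.addLabel] using hL
    -- A facet with an `inr` label misses at least two `inl` labels, and adding either one keeps the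
    -- number of `inr` labels. Without `inr` labels only one `inl` label is missing, and the second
    -- vertex comes from adding `inr 0`.
    by_cases h1 : 1 ≤ L.1.toRight.card
    · obtain ⟨n, hn, q, hq, hne⟩ := Finset.one_lt_card.1 (show 1 < L.1.toLeftᶜ.card by omega)
      rw [Finset.mem_compl, Finset.mem_toLeft] at hn hq
      exact line L (L.addLabel _ hn) (L.addLabel _ hq)
        (fun e => hne (Sum.inl_injective (L.addLabel_injective _ _ e)))
        (L.incident_addLabel _ _) (L.incident_addLabel _ _) (hpt _ (cardl n hn))
        (hpt _ (cardl q hq))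
    · obtain ⟨n, hn⟩ := Finset.card_pos.1 (show 0 < L.1.toLeftᶜ.card by omega)
      rw [Finset.mem_compl, Finset.mem_toLeft] at hn
      have h0 : L.1.toRight = ∅ := Finset.card_eq_zero.1 (by omega)
      have hm : (Sum.inr 0 : Label i j) ∉ L.1 := by
        rw [← Finset.mem_toRight, h0]; simp
      exact line L (L.addLabel _ hn) (L.addLabel _ hm)
        (fun e => Sum.inl_ne_inr (L.addLabel_injective _ _ e))
        (L.incident_addLabel _ _) (L.incident_addLabel _ _) (hpt _ (cardl n hn))
        (hpt _ (by simpa [Facet.addLabel, h0] using hk))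
  have points : ∀ k, ∀ S : Vertex i j, S.1.toRight.card ≤ k + 1 → x' S = x S := by
    intro k
    induction k with
    | zero =>
      intro S hS
      rcases Nat.le_one_iff_eq_zero_or_eq_one.1 hS with h0 | h1
      · rw [eq_baseVertex_of_toRight_card h0, hbase]
      · obtain ⟨m, n, rfl⟩ := eq_arrayVertex_of_toRight_card h1
        exact harray m n
    | succ k ih =>
      intro S hS
      by_cases hlt : S.1.toRight.card ≤ k + 1
      · exact ih S hlt
      obtain ⟨c, hc, d, hd, hcd⟩ := Finset.one_lt_card.1 (show 1 < S.1.toRight.card by omega)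
      rw [Finset.mem_toRight] at hc hd
      have low : ∀ c, ∀ hc : Sum.inr c ∈ S.1,
          (S.removeLabel _ hc).1.toRight.card ≤ k + 1 := by
        intro c hc
        have : (S.removeLabel _ hc).1.toRight = S.1.toRight.erase c := by
          ext e; simp [Vertex.removeLabel]
        rw [this, Finset.card_erase_of_mem (Finset.mem_toRight.2 hc)]
        omega
      have e1 := lines (k + 1) (by omega) ih _ (low c hc)
      have e2 := lines (k + 1) (by omega) ih _ (low d hd)
      -- Were `x' S` and `x S` different, both would lie on the images of the two facets obtained by
      -- removing `c` and `d`; these lines would then be equal, against injectivity of `l`.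
      by_contra hne
      refine hcd (Sum.inr_injective (S.removeLabel_injective hc hd (hl ?_)))
      exact hI _ _ _ _ hne (e1 ▸ h' S _ (S.incident_removeLabel _ _))
        (h S _ (S.incident_removeLabel _ _)) (e2 ▸ h' S _ (S.incident_removeLabel _ _))
        (h S _ (S.incident_removeLabel _ _))
  have hpt : ∀ S, x' S = x S := fun S => points S.1.toRight.card S (by omega)
  exact ⟨funext hpt, funext fun L =>
    lines (L.1.toRight.card + 1) (by omega) (fun S _ => hpt S) L (by omega)⟩

/-! ### Combinatorial symmetries are permutations of the labels -/

theorem mem_permSubsets {α : Type*} {σ : Equiv.Perm α} {k : ℕ}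
    {S : {S : Finset α // S.card = k}} {e : α} :
    σ e ∈ (permSubsets σ k S).1 ↔ e ∈ S.1 := by
  simp [permSubsets]

theorem permSubsets_eq_iff {α : Type*} {σ : Equiv.Perm α} {k : ℕ}
    {S T : {S : Finset α // S.card = k}} :
    permSubsets σ k S = T ↔ ∀ e ∈ S.1, σ e ∈ T.1 := by
  constructor
  · rintro rfl e he
    exact mem_permSubsets.2 he
  · intro h
    refine Subtype.ext (Finset.eq_of_subset_of_card_le ?_ ?_)
    · intro e he
      obtain ⟨f, hf, rfl⟩ := Finset.mem_map.1 he
      exact h f hf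
    · rw [T.2, (permSubsets σ k S).2]

theorem permSubsets_mul {α : Type*} (σ τ : Equiv.Perm α) (k : ℕ)
    (S : {S : Finset α // S.card = k}) :
    permSubsets (σ * τ) k S = permSubsets σ k (permSubsets τ k S) := by
  rw [permSubsets_eq_iff]
  intro e he
  exact mem_permSubsets.2 (mem_permSubsets.2 he)

/-- The label permutation is read off near the base vertex: `inl n` goes to the label that the image
of the n-th base facet lacks, `inr m` to the label that the image of an array vertex gains. The
induced symmetry then agrees with `φ` on the base and array vertices, and propagation finishes. -/
theorem Symmetry.exists_ofPerm (hj : 1 ≤ j) (φ : Symmetry i j) :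
    ∃ σ, Symmetry.ofPerm σ = φ := by
  have hbase n := (φ.incident_iff _ _).2 (incident_baseVertex (i := i) (j := j) n)
  have harr m n := (φ.incident_iff _ _).2 (incident_arrayVertex (i := i) (j := j) m n)
  choose a ha hLa haL using fun n => (hbase n).exists_removeLabel
  choose b hb hSb using fun m n => (harr m n).exists_addLabel
  set S₀ := φ.onVertex (baseVertex i j) with hS₀
  have ha_inj : Function.Injective a := by
    intro n q hnq
    have : baseFacet i n = baseFacet i q := by
      apply φ.onFacet.injective
      rw [hLa, hLa]
      simp only [hnq]
    by_contra hne
    have hm : (Sum.inl n : Label i j) ∈ (baseFacet i n).1 := by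
      rw [this]; exact mem_baseFacet.2 ⟨n, hne, rfl⟩
    simp [mem_baseFacet] at hm
  have hbS : ∀ m n, b m n ∉ S₀.1 := by
    intro m n hmem
    apply baseVertex_ne_arrayVertex m n
    apply φ.onVertex.injective
    rw [hSb]
    refine Subtype.ext (Eq.symm (Finset.eq_of_subset_of_card_le ?_ ?_))
    · exact Finset.insert_subset hmem (hbase n)
    · exact S₀.2.trans_le (Facet.addLabel _ _ (hb m n)).2.ge
  have hmemL : ∀ n e, e ∈ (φ.onFacet (baseFacet i n)).1 ↔ e ≠ a n ∧ e ∈ S₀.1 := by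
    intro n e
    rw [hLa]
    exact Finset.mem_erase
  have hmemS : ∀ m n e, e ∈ (φ.onVertex (arrayVertex m n)).1 ↔
      e = b m n ∨ (e ≠ a n ∧ e ∈ S₀.1) := by
    intro m n e
    rw [← hmemL, hSb]
    exact Finset.mem_insert
  have hbn : ∀ m n q, b m n = b m q := by
    intro m n q
    by_cases hnq : n = q
    · rw [hnq]
    by_contra hne
    -- `T` is the facet common to the array vertices `(m, n)` and `(m, q)`. If their new labels
    -- differed, its image would lie in the image of the base vertex minus two labels, which has
    -- only j-1 elements.
    let T : Facet i j := (arrayVertex m n).removeLabel (Sum.inl q)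
      (mem_arrayVertex.2 (.inr ⟨q, Ne.symm hnq, rfl⟩))
    have hT1 := (φ.incident_iff _ T).2 (Vertex.incident_removeLabel _ _ _)
    have hT2 : Incident (φ.onVertex (arrayVertex m q)) (φ.onFacet T) := by
      rw [φ.incident_iff]
      intro e he
      obtain ⟨h1, h2⟩ := Finset.mem_erase.1 he
      rw [mem_arrayVertex] at h2 ⊢
      rcases h2 with h2 | ⟨p, hp, rfl⟩
      · exact .inl h2
      · exact .inr ⟨p, fun h => h1 (h ▸ rfl), rfl⟩
    have hsub : (φ.onFacet T).1 ⊆ (S₀.1.erase (a n)).erase (a q) := by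
      intro e he
      have h1 := (hmemS m n e).1 (hT1 he)
      have h2 := (hmemS m q e).1 (hT2 he)
      simp only [Finset.mem_erase]
      rcases h1 with rfl | h1
      · rcases h2 with h2 | h2
        · exact absurd h2 hne
        · exact absurd h2.2 (hbS m n)
      · rcases h2 with rfl | h2
        · exact absurd h1.2 (hbS m q)
        · exact ⟨h2.1, h1⟩
    have := Finset.card_le_card hsub
    rw [(φ.onFacet T).2, Finset.card_erase_of_mem, Finset.card_erase_of_mem (ha n), S₀.2] at this
    · omega
    · exact Finset.mem_erase.2 ⟨fun h => hnq (ha_inj h.symm), ha q⟩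
  have hinj : Function.Injective (Sum.elim a (fun m => b m 0)) := by
    rintro (n | m) (q | p) h
    · exact congrArg _ (ha_inj h)
    · exact absurd (show b p 0 ∈ S₀.1 from (show a n = b p 0 from h) ▸ ha n) (hbS p 0)
    · exact absurd (show b m 0 ∈ S₀.1 from (show b m 0 = a q from h) ▸ ha q) (hbS m 0)
    · have h : b m 0 = b p 0 := h
      have : arrayVertex m 0 = arrayVertex (j := j) p 0 := by
        apply φ.onVertex.injective
        rw [hSb, hSb]
        simp only [h]
      have hm : (Sum.inr m : Label i j) ∈ (arrayVertex p (0 : Fin (j + 1))).1 := by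
        rw [← this]; exact mem_arrayVertex.2 (.inl rfl)
      rcases mem_arrayVertex.1 hm with h | ⟨_, -, h⟩
      · exact h
      · simp at h
  let σ : Equiv.Perm (Label i j) := Equiv.ofBijective _ (Finite.injective_iff_bijective.1 hinj)
  have hσl : ∀ n, σ (Sum.inl n) = a n := fun n => rfl
  have hσr : ∀ m, σ (Sum.inr m) = b m 0 := fun m => rfl
  have := config_maps_agree Incident
    (fun p q l l' hpq h1 h2 h3 h4 => Incident.facet_unique hpq h1 h2 h3 h4)
    φ.onVertex.injective φ.onFacet.injective
    (fun S L h => (φ.incident_iff S L).2 h)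
    (fun S L h => ((Symmetry.ofPerm σ).incident_iff S L).2 h)
    (by
      refine permSubsets_eq_iff.2 fun e he => ?_
      obtain ⟨n, rfl⟩ := mem_baseVertex.1 he
      exact ha n)
    (by
      intro m n
      refine permSubsets_eq_iff.2 fun e he => ?_
      rw [hmemS]
      rcases mem_arrayVertex.1 he with rfl | ⟨q, hq, rfl⟩
      · exact .inl (hbn m 0 n)
      · exact .inr ⟨fun h => hq (ha_inj h), ha q⟩)
  exact ⟨σ, Symmetry.ext (DFunLike.coe_injective this.1) (DFunLike.coe_injective this.2)⟩

end Incidence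

/-! ### The hyperplane arrangement and Cramer's rule, over a commutative ring -/

section Configuration

variable {i j M : ℕ}

section CommRing

variable {A B : Type*} [CommRing A] [CommRing B]

/-- The linear part of the equation of the hyperplane attached to a label. The hyperplane of `inl n`
is a coordinate hyperplane, that of `inr m` cuts the `n`-th coordinate axis at `c m n`. -/
def planeCoeff (c : Fin (i + 1) → Fin (j + 1) → A) : Label i j → Fin (j + 1) → A
  | .inl n => Pi.single n 1
  | .inr m => fun n => ∏ q ∈ Finset.univ.erase n, c m q

/-- The right-hand side of the equation of the hyperplane attached to a label. -/
def planeConst (c : Fin (i + 1) → Fin (j + 1) → A) : Label i j → A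
  | .inl _ => 0
  | .inr m => ∏ q, c m q

/-- The coefficient matrix of the equations of the hyperplanes through a vertex. -/
noncomputable def vertexMatrix (c : Fin (i + 1) → Fin (j + 1) → A) (S : Vertex i j) :
    Matrix (Fin (j + 1)) (Fin (j + 1)) A :=
  Matrix.of fun k => planeCoeff c ((S.1.equivFinOfCardEq S.2).symm k).1

/-- The common denominator of the coordinates of a vertex. -/
noncomputable def vertexDet (c : Fin (i + 1) → Fin (j + 1) → A) (S : Vertex i j) : A :=
  (vertexMatrix c S).det

/-- The numerators of the coordinates of a vertex, by Cramer's rule. -/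
noncomputable def vertexNum (c : Fin (i + 1) → Fin (j + 1) → A) (S : Vertex i j) :
    Fin (j + 1) → A :=
  (vertexMatrix c S).cramer fun k => planeConst c ((S.1.equivFinOfCardEq S.2).symm k).1

/-- The numerators of the difference of two vertices. -/
noncomputable def displacement (c : Fin (i + 1) → Fin (j + 1) → A) (S T : Vertex i j) :
    Fin (j + 1) → A :=
  fun n => vertexDet c S * vertexNum c T n - vertexDet c T * vertexNum c S n

/-- The positions of the additional points. -/
def coefficients (θ : DataVar i j M → A) : Fin (i + 1) → Fin (j + 1) → A :=
  fun m n => θ (.coef m n)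

/-- The numerator of a coordinate of the difference of two projected vertices. -/
noncomputable def separation (θ : DataVar i j M → A) (S T : Vertex i j) (a : Fin M) : A :=
  ∑ n, displacement (coefficients θ) S T n * θ (.dir n a)

/-- The expression in the coordinates `a`, `b` that vanishes if three projected vertices are
collinear. -/
noncomputable def collinearity (θ : DataVar i j M → A) (S T T' : Vertex i j) (a b : Fin M) : A :=
  separation θ S T a * separation θ S T' b - separation θ S T b * separation θ S T' a

theorem map_planeCoeff (f : A →+* B) (c : Fin (i + 1) → Fin (j + 1) → A) (e : Label i j)
    (n : Fin (j + 1)) :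
    f (planeCoeff c e n) = planeCoeff (fun m n => f (c m n)) e n := by
  rcases e with q | m
  · simp only [planeCoeff, Pi.single_apply]
    split_ifs <;> simp
  · simp [planeCoeff, map_prod]

theorem map_planeConst (f : A →+* B) (c : Fin (i + 1) → Fin (j + 1) → A) (e : Label i j) :
    f (planeConst c e) = planeConst (fun m n => f (c m n)) e := by
  rcases e with q | m
  · simp [planeConst]
  · simp [planeConst, map_prod]

theorem map_vertexMatrix (f : A →+* B) (c : Fin (i + 1) → Fin (j + 1) → A) (S : Vertex i j) :
    f.mapMatrix (vertexMatrix c S) = vertexMatrix (fun m n => f (c m n)) S := by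
  ext k n
  exact map_planeCoeff f c _ n

theorem map_vertexDet (f : A →+* B) (c : Fin (i + 1) → Fin (j + 1) → A) (S : Vertex i j) :
    f (vertexDet c S) = vertexDet (fun m n => f (c m n)) S := by
  rw [vertexDet, vertexDet, RingHom.map_det, map_vertexMatrix]

theorem map_vertexNum (f : A →+* B) (c : Fin (i + 1) → Fin (j + 1) → A) (S : Vertex i j)
    (n : Fin (j + 1)) :
    f (vertexNum c S n) = vertexNum (fun m n => f (c m n)) S n := by
  simp only [vertexNum, Matrix.cramer_eq_adjugate_mulVec, Matrix.mulVec, dotProduct, map_sum,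
    map_mul, map_planeConst, ← map_vertexMatrix, ← RingHom.map_adjugate]
  rfl

theorem map_separation (f : A →+* B) (θ : DataVar i j M → A) (S T : Vertex i j) (a : Fin M) :
    f (separation θ S T a) = separation (fun v => f (θ v)) S T a := by
  simp only [separation, displacement, map_sum, map_mul, map_sub, map_vertexDet, map_vertexNum]
  rfl

theorem map_collinearity (f : A →+* B) (θ : DataVar i j M → A) (S T T' : Vertex i j)
    (a b : Fin M) :
    f (collinearity θ S T T' a b) = collinearity (fun v => f (θ v)) S T T' a b := by
  simp only [collinearity, map_mul, map_sub, map_separation]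

theorem forall_vertex {S : Vertex i j} {p : Label i j → Prop}
    (h : ∀ k, p ((S.1.equivFinOfCardEq S.2).symm k).1) {e : Label i j} (he : e ∈ S.1) : p e := by
  simpa using h (S.1.equivFinOfCardEq S.2 ⟨e, he⟩)

theorem planeCoeff_dotProduct_vertexNum (c : Fin (i + 1) → Fin (j + 1) → A) {S : Vertex i j}
    {e : Label i j} (he : e ∈ S.1) :
    planeCoeff c e ⬝ᵥ vertexNum c S = vertexDet c S * planeConst c e := by
  refine forall_vertex (p := fun e => planeCoeff c e ⬝ᵥ vertexNum c S =
    vertexDet c S * planeConst c e) (fun k => ?_) he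
  exact congrFun (Matrix.mulVec_cramer (vertexMatrix c S) _) k

theorem planeCoeff_dotProduct_displacement (c : Fin (i + 1) → Fin (j + 1) → A) {S T : Vertex i j}
    {e : Label i j} (he : e ∈ T.1) :
    planeCoeff c e ⬝ᵥ displacement c S T =
      vertexDet c T * (vertexDet c S * planeConst c e - planeCoeff c e ⬝ᵥ vertexNum c S) := by
  have : displacement c S T = vertexDet c S • vertexNum c T - vertexDet c T • vertexNum c S := rfl
  rw [this, dotProduct_sub, dotProduct_smul, dotProduct_smul,
    planeCoeff_dotProduct_vertexNum c he]
  simp only [smul_eq_mul]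
  ring

end CommRing

section Field

variable {K : Type*} [Field K]

theorem eq_zero_of_vertexDet_ne_zero {c : Fin (i + 1) → Fin (j + 1) → K} {S : Vertex i j}
    (hS : vertexDet c S ≠ 0) {v : Fin (j + 1) → K} (hv : ∀ e ∈ S.1, planeCoeff c e ⬝ᵥ v = 0) :
    v = 0 :=
  Matrix.eq_zero_of_mulVec_eq_zero hS (funext fun _ => hv _ (Subtype.prop _))

/-! ### Nondegenerate parameters from differences of labels -/

section Witness

open Polynomial

variable (r : Label i j → K)

/-- A polynomial whose values at the parameters `r e` measure whether the vector `v` satisfies the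
equations, homogenised by `s`, of the hyperplanes with `c m n = r (inr m) - r (inl n)`. -/
noncomputable def incidencePoly (s : K) (v : Fin (j + 1) → K) : K[X] :=
  C s * ∏ n, (X - C (r (.inl n))) -
    ∑ n, C (v n) * ∏ q ∈ Finset.univ.erase n, (X - C (r (.inl q)))

theorem eval_incidencePoly_inr (s : K) (v : Fin (j + 1) → K) (m : Fin (i + 1)) :
    (incidencePoly r s v).eval (r (.inr m)) =
      s * planeConst (fun m n => r (.inr m) - r (.inl n)) (.inr m : Label i j) -
        planeCoeff (fun m n => r (.inr m) - r (.inl n)) (.inr m : Label i j) ⬝ᵥ v := by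
  simp [incidencePoly, eval_prod, eval_finsetSum, planeConst, planeCoeff, dotProduct, mul_comm]

theorem eval_incidencePoly_inl (s : K) (v : Fin (j + 1) → K) (n : Fin (j + 1)) :
    (incidencePoly r s v).eval (r (.inl n)) =
      -(v n * ∏ q ∈ Finset.univ.erase n, (r (.inl n) - r (.inl q))) := by
  simp only [incidencePoly, eval_sub, eval_mul, eval_C, eval_prod, eval_X, eval_finsetSum]
  rw [Finset.prod_eq_zero (Finset.mem_univ n) (sub_self _), mul_zero, zero_sub,
    Finset.sum_eq_single n]
  · intro q _ hq
    rw [Finset.prod_eq_zero (Finset.mem_erase.2 ⟨hq.symm, Finset.mem_univ n⟩) (sub_self _),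
      mul_zero]
  · simp

theorem C_mul_prod_mem_degreeLT (s : K) (t : Finset (Fin (j + 1))) {d : ℕ} (hd : t.card < d) :
    C s * ∏ n ∈ t, (X - C (r (.inl n))) ∈ degreeLT K d := by
  rw [← smul_eq_C_mul]
  refine Submodule.smul_mem _ _ ?_
  rw [mem_degreeLT, degree_prod]
  simpa using hd

theorem degree_incidencePoly_lt (s : K) (v : Fin (j + 1) → K) :
    (incidencePoly r s v).degree < ((j + 2 : ℕ) : WithBot ℕ) := by
  rw [← mem_degreeLT]
  exact Submodule.sub_mem _ (C_mul_prod_mem_degreeLT r s _ (by simp))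
    (Submodule.sum_mem _ fun n _ => C_mul_prod_mem_degreeLT r _ _ (by simp))

theorem degree_incidencePoly_zero_lt (v : Fin (j + 1) → K) :
    (incidencePoly r 0 v).degree < ((j + 1 : ℕ) : WithBot ℕ) := by
  rw [← mem_degreeLT, incidencePoly, C_0, zero_mul, zero_sub]
  exact Submodule.neg_mem _
    (Submodule.sum_mem _ fun n _ => C_mul_prod_mem_degreeLT r _ _ (by simp))

variable {r}

theorem eq_zero_of_incidencePoly_eq_zero (hr : Function.Injective r) {s : K}
    {v : Fin (j + 1) → K} (h : incidencePoly r s v = 0) : s = 0 ∧ v = 0 := by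
  have hv : v = 0 := by
    funext n
    have h0 := eval_incidencePoly_inl r s v n
    rw [h, eval_zero, eq_comm, neg_eq_zero, mul_eq_zero] at h0
    refine h0.resolve_right (Finset.prod_ne_zero_iff.2 fun q hq => sub_ne_zero.2 fun he => ?_)
    exact (Finset.mem_erase.1 hq).1 (Sum.inl_injective (hr he)).symm
  refine ⟨?_, hv⟩
  subst hv
  simp only [incidencePoly, Pi.zero_apply, C_0, zero_mul, Finset.sum_const_zero, sub_zero,
    mul_eq_zero, C_eq_zero] at h
  exact h.resolve_right (Finset.prod_ne_zero_iff.2 fun q _ => X_sub_C_ne_zero _)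

theorem eval_incidencePoly_eq_zero {s : K} {v : Fin (j + 1) → K} {e : Label i j}
    (h : planeCoeff (fun m n => r (.inr m) - r (.inl n)) e ⬝ᵥ v =
      s * planeConst (fun m n => r (.inr m) - r (.inl n)) e) :
    (incidencePoly r s v).eval (r e) = 0 := by
  rcases e with n | m
  · rw [eval_incidencePoly_inl]
    simp only [planeCoeff, single_one_dotProduct, planeConst, mul_zero] at h
    rw [h, zero_mul, neg_zero]
  · rw [eval_incidencePoly_inr, h, sub_self]

/-- A kernel vector gives an incidence polynomial with `s = 0`, of degree at most j, vanishing at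
the j+1 parameters of `S`. -/
theorem vertexDet_witness_ne_zero (hr : Function.Injective r) (S : Vertex i j) :
    vertexDet (fun m n => r (.inr m) - r (.inl n)) S ≠ 0 := by
  intro h0
  obtain ⟨v, hv0, hv⟩ := Matrix.exists_mulVec_eq_zero_iff.2 h0
  refine hv0 (eq_zero_of_incidencePoly_eq_zero hr (s := 0) ?_).2
  refine eq_zero_of_degree_lt_of_eval_index_eq_zero (v := r) S.1 hr.injOn ?_ fun e he => ?_
  · rw [S.2]; exact degree_incidencePoly_zero_lt r v
  · refine eval_incidencePoly_eq_zero ?_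
    rw [zero_mul]
    exact forall_vertex 
      (p := fun e => planeCoeff (fun m n => r (.inr m) - r (.inl n)) e ⬝ᵥ v = 0)
      (fun k => congrFun hv k) he

/-- No vertex lies on a further hyperplane: otherwise a polynomial of degree at most j+1 would have
j+2 roots, forcing its leading factor `vertexDet` to vanish. -/
theorem planeCoeff_dotProduct_vertexNum_witness_ne (hr : Function.Injective r) {S : Vertex i j}
    {e : Label i j} (he : e ∉ S.1) :
    planeCoeff (fun m n => r (.inr m) - r (.inl n)) e ⬝ᵥ
        vertexNum (fun m n => r (.inr m) - r (.inl n)) S ≠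
      vertexDet (fun m n => r (.inr m) - r (.inl n)) S *
        planeConst (fun m n => r (.inr m) - r (.inl n)) e := by
  intro h0
  refine vertexDet_witness_ne_zero hr S (eq_zero_of_incidencePoly_eq_zero hr (v := vertexNum
    (fun m n => r (.inr m) - r (.inl n)) S) ?_).1
  refine eq_zero_of_degree_lt_of_eval_index_eq_zero (v := r) (insert e S.1) hr.injOn ?_
    fun f hf => eval_incidencePoly_eq_zero ?_
  · rw [Finset.card_insert_of_notMem he, S.2]; exact degree_incidencePoly_lt r _ _
  · rcases Finset.mem_insert.1 hf with rfl | hf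
    · exact h0
    · exact planeCoeff_dotProduct_vertexNum _ hf

theorem planeCoeff_dotProduct_displacement_witness_ne_zero (hr : Function.Injective r)
    {S T : Vertex i j} {e : Label i j} (hT : e ∈ T.1) (hS : e ∉ S.1) :
    planeCoeff (fun m n => r (.inr m) - r (.inl n)) e ⬝ᵥ
        displacement (fun m n => r (.inr m) - r (.inl n)) S T ≠ 0 := by
  rw [planeCoeff_dotProduct_displacement _ hT]
  exact mul_ne_zero (vertexDet_witness_ne_zero hr T)
    (sub_ne_zero.2 (planeCoeff_dotProduct_vertexNum_witness_ne hr hS).symm)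

theorem exists_displacement_witness_ne_zero (hr : Function.Injective r) {S T : Vertex i j}
    (hST : S ≠ T) : ∃ n, displacement (fun m n => r (.inr m) - r (.inl n)) S T n ≠ 0 := by
  obtain ⟨e, heT, heS⟩ := Finset.not_subset.1 fun h : T.1 ⊆ S.1 =>
    hST (Subtype.ext (Finset.eq_of_subset_of_card_le h (by rw [S.2, T.2])).symm)
  by_contra! h
  refine planeCoeff_dotProduct_displacement_witness_ne_zero hr heT heS ?_
  rw [show displacement _ S T = 0 from funext h, dotProduct_zero]

/-- `T` and `T'` are distinct points of the hyperplane `e` and `S` is off it, so the three are not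
collinear. -/
theorem exists_minor_witness_ne_zero (hr : Function.Injective r) {S T T' : Vertex i j}
    {e : Label i j} (hTT' : T ≠ T') (hT : e ∈ T.1) (hT' : e ∈ T'.1) (hS : e ∉ S.1) :
    ∃ n q, displacement (fun m n => r (.inr m) - r (.inl n)) S T n *
        displacement (fun m n => r (.inr m) - r (.inl n)) S T' q -
      displacement (fun m n => r (.inr m) - r (.inl n)) S T q *
        displacement (fun m n => r (.inr m) - r (.inl n)) S T' n ≠ 0 := by
  set c : Fin (i + 1) → Fin (j + 1) → K := fun m n => r (.inr m) - r (.inl n) with hc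
  by_contra! h
  have hv := planeCoeff_dotProduct_displacement c (S := S) hT
  have hw := planeCoeff_dotProduct_displacement c (S := S) hT'
  set κ := vertexDet c S * planeConst c e - planeCoeff c e ⬝ᵥ vertexNum c S with hκ
  have hκ0 : κ ≠ 0 :=
    sub_ne_zero.2 (planeCoeff_dotProduct_vertexNum_witness_ne hr hS).symm
  have hS0 : vertexDet c S ≠ 0 := vertexDet_witness_ne_zero hr S
  obtain ⟨q, hq⟩ := exists_displacement_witness_ne_zero hr hTT'
  -- Vanishing minors make the two displacements proportional; the equation of `e` identifies the
  -- factor, which forces the displacement from `T` to `T'` to be zero.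
  have h1 : (planeCoeff c e ⬝ᵥ displacement c S T) * displacement c S T' q =
      displacement c S T q * (planeCoeff c e ⬝ᵥ displacement c S T') := by
    simp only [dotProduct, Finset.sum_mul, Finset.mul_sum]
    refine Finset.sum_congr rfl fun n _ => ?_
    linear_combination planeCoeff c e n * h n q
  rw [hv, hw] at h1
  have h2 : κ * vertexDet c S * displacement c T T' q = 0 := by
    simp only [displacement] at h1 ⊢
    linear_combination h1
  exact mul_ne_zero (mul_ne_zero hκ0 hS0) hq h2

end Witness

end Field

end Configuration

/-! ### General position as one integer polynomial -/

section GeneralPosition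

variable {i j M : ℕ}

/-- Parameters in general position, with respect to two coordinates `a`, `b` of the target. -/
structure IsGeneral {K : Type*} [Field K] (θ : DataVar i j M → K) (a b : Fin M) : Prop where
  vertexDet_ne : ∀ S, vertexDet (coefficients θ) S ≠ 0
  separation_ne : ∀ S T a, S ≠ T → separation θ S T a ≠ 0
  collinearity_ne : ∀ S T T', T ≠ T' → ¬ T.1 ∩ T'.1 ⊆ S.1 → collinearity θ S T T' a b ≠ 0

open MvPolynomial

/-- One nonzero value in an extension of `K` suffices, which allows witnesses in the algebraic
closure when `K` is a small finite field. -/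
theorem map_intCast_ne_zero_of_aeval {σ K F : Type*} [Field K] [Field F] [Algebra K F]
    {p : MvPolynomial σ ℤ} (θ : σ → F) (h : aeval θ p ≠ 0) : map (Int.castRingHom K) p ≠ 0 := by
  intro h0
  apply h
  have : aeval θ (map (Int.castRingHom K) p) = aeval θ p := by
    rw [aeval_def, aeval_def, eval₂_map]
    congr 1
    exact RingHom.ext_int _ _
  rw [← this, h0, map_zero]

theorem aeval_vertexDet {K : Type*} [Field K] (θ : DataVar i j M → K) (S : Vertex i j) :
    aeval θ (vertexDet (coefficients (X : DataVar i j M → MvPolynomial _ ℤ)) S) =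
      vertexDet (coefficients θ) S := by
  refine (map_vertexDet (aeval θ : MvPolynomial _ ℤ →ₐ[ℤ] K).toRingHom _ S).trans
    (congrArg (vertexDet · S) ?_)
  funext m n
  simp [coefficients]

theorem aeval_separation {K : Type*} [Field K] (θ : DataVar i j M → K) (S T : Vertex i j)
    (a : Fin M) :
    aeval θ (separation (X : DataVar i j M → MvPolynomial _ ℤ) S T a) = separation θ S T a := by
  refine (map_separation (aeval θ : MvPolynomial _ ℤ →ₐ[ℤ] K).toRingHom _ S T a).trans ?_
  simp

theorem aeval_collinearity {K : Type*} [Field K] (θ : DataVar i j M → K) (S T T' : Vertex i j)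
    (a b : Fin M) :
    aeval θ (collinearity (X : DataVar i j M → MvPolynomial _ ℤ) S T T' a b) =
      collinearity θ S T T' a b := by
  refine (map_collinearity (aeval θ : MvPolynomial _ ℤ →ₐ[ℤ] K).toRingHom _ S T T' a b).trans ?_
  simp

/-- Over every field, there is an injective labelling by elements of an extension. -/
theorem exists_injective_label (i j : ℕ) (K : Type*) [Field K] :
    ∃ r : Label i j → AlgebraicClosure K, Function.Injective r :=
  haveI : Infinite (AlgebraicClosure K) := IsAlgClosed.instInfinite
  ⟨fun e => Infinite.natEmbedding _ (Fintype.equivFin (Label i j) e),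
    (Infinite.natEmbedding _).injective.comp
      (Fin.val_injective.comp (Fintype.equivFin _).injective)⟩

/-- The parameters with given directions and with additional points at `r (inr m) - r (inl n)`. -/
def witness {F : Type*} [Field F] (r : Label i j → F) (d : Fin (j + 1) → Fin M → F) :
    DataVar i j M → F
  | .base _ => 0
  | .dir n a => d n a
  | .coef m n => r (.inr m) - r (.inl n)

theorem coefficients_witness {F : Type*} [Field F] (r : Label i j → F)
    (d : Fin (j + 1) → Fin M → F) :
    coefficients (witness r d) = fun m n => r (.inr m) - r (.inl n) :=
  rfl

theorem exists_generalPosition (i j M : ℕ) {a b : Fin M} (hab : a ≠ b) :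
    ∃ P : MvPolynomial (DataVar i j M) ℤ, ∀ (K : Type*) [Field K],
      map (Int.castRingHom K) P ≠ 0 ∧
        ∀ θ : DataVar i j M → K, aeval θ P ≠ 0 → IsGeneral θ a b := by
  classical
  refine ⟨(∏ S : Vertex i j, vertexDet (coefficients X) S) *
    (∏ S : Vertex i j, ∏ T : Vertex i j, ∏ a : Fin M,
      if S ≠ T then separation X S T a else 1) *
    (∏ S : Vertex i j, ∏ T : Vertex i j, ∏ T' : Vertex i j,
      if T ≠ T' ∧ ¬ T.1 ∩ T'.1 ⊆ S.1 then collinearity X S T T' a b else 1),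
    fun K _ => ⟨?_, fun θ h => ?_⟩⟩
  · obtain ⟨r, hr⟩ := exists_injective_label i j K
    simp only [map_mul, map_prod, mul_ne_zero_iff, Finset.prod_ne_zero_iff]
    refine ⟨⟨fun S _ => ?_, fun S _ T _ a' _ => ?_⟩, fun S _ T _ T' _ => ?_⟩
    · refine map_intCast_ne_zero_of_aeval (witness r 0) ?_
      rw [aeval_vertexDet]
      exact vertexDet_witness_ne_zero hr S
    · split_ifs with hST
      · obtain ⟨n, hn⟩ := exists_displacement_witness_ne_zero hr hST
        -- With these directions every target coordinate is the n-th lifted coordinate, so the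
        -- separation is the n-th displacement.
        refine map_intCast_ne_zero_of_aeval (witness r fun q _ => if q = n then 1 else 0) ?_
        rw [aeval_separation]
        simpa [separation, coefficients_witness, witness] using hn
      · simp
    · split_ifs with hT
      · obtain ⟨e, he, heS⟩ := Finset.not_subset.1 hT.2
        obtain ⟨heT, heT'⟩ := Finset.mem_inter.1 he
        obtain ⟨n, q, hnq⟩ := exists_minor_witness_ne_zero hr hT.1 heT heT' heS
        -- Coordinate `a` reads the n-th lifted coordinate and `b` the q-th, which turns the
        -- collinearity expression into the chosen minor.
        refine map_intCast_ne_zero_of_aeval (witness r fun p a' =>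
          if a' = a then (if p = n then 1 else 0) else if p = q then 1 else 0) ?_
        rw [aeval_collinearity]
        simpa [collinearity, separation, coefficients_witness, witness, hab.symm] using hnq
      · simp
  · simp only [map_mul, map_prod, mul_ne_zero_iff, Finset.prod_ne_zero_iff] at h
    refine ⟨fun S => ?_, fun S T a' hST => ?_, fun S T T' hT hS => ?_⟩
    · rw [← aeval_vertexDet]
      exact h.1.1 S (Finset.mem_univ _)
    · have := h.1.2 S (Finset.mem_univ _) T (Finset.mem_univ _) a' (Finset.mem_univ _)
      rwa [if_pos hST, aeval_separation] at this
    · have := h.2 S (Finset.mem_univ _) T (Finset.mem_univ _) T' (Finset.mem_univ _)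
      rwa [if_pos ⟨hT, hS⟩, aeval_collinearity] at this

end GeneralPosition

/-! ### Projected vertices and their collinearities -/

section Points

variable {i j M : ℕ} {K : Type*} [Field K]

/-- The vertex of the configuration of hyperplanes, before projection to the target. -/
noncomputable def liftedPoint (c : Fin (i + 1) → Fin (j + 1) → K) (S : Vertex i j) :
    Fin (j + 1) → K :=
  fun n => vertexNum c S n / vertexDet c S

/-- The value at a vertex of the equation of the hyperplane of a label. -/
noncomputable def gap (c : Fin (i + 1) → Fin (j + 1) → K) (S : Vertex i j) (e : Label i j) : K :=
  planeCoeff c e ⬝ᵥ liftedPoint c S - planeConst c e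

/-- The projected vertices. -/
noncomputable def configPoint (θ : DataVar i j M → K) (S : Vertex i j) : Fin M → K :=
  fun a => θ (.base a) + ∑ n, liftedPoint (coefficients θ) S n * θ (.dir n a)

theorem gap_eq_zero {c : Fin (i + 1) → Fin (j + 1) → K} {S : Vertex i j}
    (hS : vertexDet c S ≠ 0) {e : Label i j} (he : e ∈ S.1) : gap c S e = 0 := by
  have : liftedPoint c S = (vertexDet c S)⁻¹ • vertexNum c S := by
    funext n
    simp [liftedPoint, div_eq_inv_mul]
  rw [gap, this, dotProduct_smul, planeCoeff_dotProduct_vertexNum c he, smul_eq_mul,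
    inv_mul_cancel_left₀ hS, sub_self]

theorem planeCoeff_dotProduct_liftedPoint_sub (c : Fin (i + 1) → Fin (j + 1) → K)
    (S T : Vertex i j) (e : Label i j) :
    planeCoeff c e ⬝ᵥ (liftedPoint c T - liftedPoint c S) = gap c T e - gap c S e := by
  rw [dotProduct_sub, gap, gap]
  ring

theorem liftedPoint_unique {c : Fin (i + 1) → Fin (j + 1) → K} {S : Vertex i j}
    (hS : vertexDet c S ≠ 0) {v : Fin (j + 1) → K}
    (hv : ∀ e ∈ S.1, planeCoeff c e ⬝ᵥ v = planeConst c e) : liftedPoint c S = v := by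
  refine sub_eq_zero.1 (eq_zero_of_vertexDet_ne_zero hS fun e he => ?_)
  have := gap_eq_zero hS he
  rw [gap] at this
  rw [dotProduct_sub, hv e he, this]

theorem configPoint_sub (θ : DataVar i j M → K) (S T : Vertex i j) (a : Fin M) :
    configPoint θ T a - configPoint θ S a =
      ∑ n, (liftedPoint (coefficients θ) T - liftedPoint (coefficients θ) S) n * θ (.dir n a) := by
  simp only [configPoint, add_sub_add_left_eq_sub, ← Finset.sum_sub_distrib, Pi.sub_apply, sub_mul]

theorem separation_eq {θ : DataVar i j M → K} {S T : Vertex i j}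
    (hS : vertexDet (coefficients θ) S ≠ 0) (hT : vertexDet (coefficients θ) T ≠ 0) (a : Fin M) :
    separation θ S T a = vertexDet (coefficients θ) S * vertexDet (coefficients θ) T *
      (configPoint θ T a - configPoint θ S a) := by
  rw [configPoint_sub, separation, Finset.mul_sum]
  refine Finset.sum_congr rfl fun n _ => ?_
  simp only [displacement, liftedPoint, Pi.sub_apply]
  field_simp

/-- If `T` and `T'` contain all labels of `S` but `f`, then the three vertices are collinear. -/
theorem gap_mul_configPoint_sub {θ : DataVar i j M → K}
    (hdet : ∀ S, vertexDet (coefficients θ) S ≠ 0) {S T T' : Vertex i j} {f : Label i j}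
    (hT : ∀ e ∈ S.1, e ≠ f → e ∈ T.1) (hT' : ∀ e ∈ S.1, e ≠ f → e ∈ T'.1) (a : Fin M) :
    gap (coefficients θ) T' f * (configPoint θ T a - configPoint θ S a) =
      gap (coefficients θ) T f * (configPoint θ T' a - configPoint θ S a) := by
  set c := coefficients θ with hc
  -- Both differences are parallel to the hyperplanes of `S` other than `f`; the weights make the
  -- combination parallel to `f` as well, so it is zero.
  have key : gap c T' f • (liftedPoint c T - liftedPoint c S) -
      gap c T f • (liftedPoint c T' - liftedPoint c S) = 0 := by
    refine eq_zero_of_vertexDet_ne_zero (hdet S) fun e he => ?_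
    rw [dotProduct_sub, dotProduct_smul, dotProduct_smul, planeCoeff_dotProduct_liftedPoint_sub,
      planeCoeff_dotProduct_liftedPoint_sub, gap_eq_zero (hdet S) he]
    by_cases hef : e = f
    · subst hef
      simp only [smul_eq_mul]
      ring
    · rw [gap_eq_zero (hdet T) (hT e he hef), gap_eq_zero (hdet T') (hT' e he hef)]
      simp
  rw [configPoint_sub, configPoint_sub, Finset.mul_sum, Finset.mul_sum, ← sub_eq_zero,
    ← Finset.sum_sub_distrib]
  refine Finset.sum_eq_zero fun n _ => ?_
  have := congrFun key n
  simp only [Pi.sub_apply, Pi.smul_apply, smul_eq_mul, Pi.zero_apply] at this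
  simp only [Pi.sub_apply, ← hc]
  linear_combination θ (.dir n a) * this

namespace IsGeneral

variable {θ : DataVar i j M → K} {a b : Fin M}

theorem configPoint_apply_ne (hθ : IsGeneral θ a b) {S T : Vertex i j} (hST : S ≠ T) (a' : Fin M) :
    configPoint θ S a' ≠ configPoint θ T a' := by
  intro h
  apply hθ.separation_ne S T a' hST
  rw [separation_eq (hθ.vertexDet_ne S) (hθ.vertexDet_ne T), h, sub_self, mul_zero]

theorem configPoint_injective (hθ : IsGeneral θ a b) : Function.Injective (configPoint θ) := by
  intro S T h
  by_contra hST
  exact hθ.configPoint_apply_ne hST a (congrFun h a)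

/-- If `T` also lay on the hyperplane `f`, it would satisfy all equations of `S`, and the two points
would coincide. -/
theorem gap_ne_zero (hθ : IsGeneral θ a b) {S T : Vertex i j} {f : Label i j} (hST : S ≠ T)
    (hT : ∀ e ∈ S.1, e ≠ f → e ∈ T.1) : gap (coefficients θ) T f ≠ 0 := by
  intro h0
  apply hST
  apply hθ.configPoint_injective
  have : liftedPoint (coefficients θ) S = liftedPoint (coefficients θ) T := by
    refine liftedPoint_unique (hθ.vertexDet_ne S) fun e he => sub_eq_zero.1 ?_
    by_cases hef : e = f
    · exact hef ▸ h0
    · exact gap_eq_zero (hθ.vertexDet_ne T) (hT e he hef)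
  funext a'
  simp only [configPoint, this]

theorem configPoint_baseVertex (hθ : IsGeneral θ a b) : configPoint θ (baseVertex i j) = (initialPoints θ).y0 := by
  have : liftedPoint (coefficients θ) (baseVertex i j) = 0 := by
    refine liftedPoint_unique (hθ.vertexDet_ne _) fun e he => ?_
    obtain ⟨n, rfl⟩ := mem_baseVertex.1 he
    simp [planeCoeff, planeConst]
  funext a'
  simp [configPoint, this, initialPoints]

theorem configPoint_arrayVertex (hθ : IsGeneral θ a b) (m : Fin (i + 1)) (n : Fin (j + 1)) :
    configPoint θ (arrayVertex m n) = (initialPoints θ).y m n := by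
  have : liftedPoint (coefficients θ) (arrayVertex m n) = Pi.single n (θ (.coef m n)) := by
    refine liftedPoint_unique (hθ.vertexDet_ne _) fun e he => ?_
    rcases mem_arrayVertex.1 he with rfl | ⟨q, hq, rfl⟩
    · simp only [planeCoeff, planeConst, dotProduct_single, coefficients]
      exact Finset.prod_erase_mul _ _ (Finset.mem_univ n)
    · simp [planeCoeff, planeConst, hq]
  funext a'
  simp [configPoint, this, initialPoints, Pi.single_apply]

end IsGeneral

end Points

/-! ### Existence, faithfulness and uniqueness of the realisation -/

section Realisation

variable {i j M : ℕ} {K : Type*} [Field K]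

theorem IsAffineLine.eq_of_mem {V : Type*} [AddCommGroup V] [Module K V]
    {l l' : AffineSubspace K V} (hl : IsAffineLine l) (hl' : IsAffineLine l') {p q : V}
    (hpq : p ≠ q) (hp : p ∈ l) (hq : q ∈ l) (hp' : p ∈ l') (hq' : q ∈ l') : l = l' := by
  have key : ∀ l : AffineSubspace K V, IsAffineLine l → p ∈ l → q ∈ l →
      l.direction = K ∙ (q - p) := by
    intro l hl hp hq
    have : FiniteDimensional K l.direction := Module.finite_of_finrank_eq_succ hl.2
    refine (Submodule.eq_of_le_of_finrank_eq ?_ ?_).symm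
    · rw [Submodule.span_singleton_le_iff_mem]
      exact AffineSubspace.vsub_mem_direction hq hp
    · rw [hl.2, finrank_span_singleton (sub_ne_zero.2 hpq.symm)]
  exact AffineSubspace.ext_of_direction_eq ((key l hl hp hq).trans (key l' hl' hp' hq').symm)
    ⟨p, hp, hp'⟩

theorem isAffineLine_mk'_span_singleton {V : Type*} [AddCommGroup V] [Module K V] (p : V) {v : V}
    (hv : v ≠ 0) : IsAffineLine (AffineSubspace.mk' p (K ∙ v)) :=
  ⟨⟨p, AffineSubspace.self_mem_mk' p _⟩, by
    rw [AffineSubspace.direction_mk', finrank_span_singleton hv]⟩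

theorem Facet.exists_two_vertices (L : Facet i j) :
    ∃ S T, S ≠ T ∧ Incident S L ∧ Incident T L := by
  have hc : 1 < L.1ᶜ.card := by
    rw [Finset.card_compl, L.2, Fintype.card_sum, Fintype.card_fin, Fintype.card_fin]
    omega
  obtain ⟨e, he, f, hf, hne⟩ := Finset.one_lt_card.1 hc
  rw [Finset.mem_compl] at he hf
  exact ⟨L.addLabel e he, L.addLabel f hf, fun h => hne (L.addLabel_injective he hf h),
    L.incident_addLabel e he, L.incident_addLabel f hf⟩

/-- Distinct facets are distinguished by their vertices. -/
theorem Facet.exists_incident_not_incident (hi : 1 ≤ i) {L L' : Facet i j} (h : L ≠ L') :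
    ∃ S, Incident S L ∧ ¬ Incident S L' := by
  obtain ⟨e, he', he⟩ := Finset.not_subset.1 fun h' : L'.1 ⊆ L.1 =>
    h (Subtype.ext (Finset.eq_of_subset_of_card_le h' (by rw [L.2, L'.2])).symm)
  have hc : 1 < L.1ᶜ.card := by
    rw [Finset.card_compl, L.2, Fintype.card_sum, Fintype.card_fin, Fintype.card_fin]
    omega
  obtain ⟨f, hf, hne⟩ := Finset.exists_mem_ne hc e
  rw [Finset.mem_compl] at hf
  refine ⟨L.addLabel f hf, L.incident_addLabel f hf, fun hI => ?_⟩
  rcases Finset.mem_insert.1 (hI he') with rfl | h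
  · exact hne rfl
  · exact he h

namespace IsGeneral

variable {θ : DataVar i j M → K} {a b : Fin M}

theorem exists_smul_configPoint_sub (hθ : IsGeneral θ a b) {L : Facet i j} {S T T' : Vertex i j}
    (hTT' : T ≠ T') (hS : Incident S L) (hT : Incident T L) (hT' : Incident T' L) :
    ∃ t : K, configPoint θ S - configPoint θ T = t • (configPoint θ T' - configPoint θ T) := by
  obtain ⟨f, hf, rfl⟩ := hT.exists_addLabel
  have mem : ∀ V : Vertex i j, Incident V L →
      ∀ e ∈ (L.addLabel f hf).1, e ≠ f → e ∈ V.1 := fun V hV e he hef =>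
    hV ((Finset.mem_insert.1 he).resolve_left hef)
  have hκ := hθ.gap_ne_zero hTT' (mem T' hT')
  refine ⟨gap (coefficients θ) S f / gap (coefficients θ) T' f, funext fun a' => ?_⟩
  have := gap_mul_configPoint_sub hθ.vertexDet_ne (mem S hS) (mem T' hT') a'
  simp only [Pi.sub_apply, Pi.smul_apply, smul_eq_mul]
  rw [div_mul_eq_mul_div, eq_div_iff hκ, mul_comm, this]

/-- The line of a facet: the line through two of its projected vertices. -/
noncomputable def configLine (θ : DataVar i j M → K) (L : Facet i j) :
    AffineSubspace K (Fin M → K) :=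
  AffineSubspace.mk' (configPoint θ L.exists_two_vertices.choose)
    (K ∙ (configPoint θ L.exists_two_vertices.choose_spec.choose -
      configPoint θ L.exists_two_vertices.choose))

theorem isAffineLine_configLine (hθ : IsGeneral θ a b) (L : Facet i j) :
    IsAffineLine (configLine θ L) :=
  isAffineLine_mk'_span_singleton _ (sub_ne_zero.2 (hθ.configPoint_injective.ne
    L.exists_two_vertices.choose_spec.choose_spec.1.symm))

theorem configPoint_mem_configLine_iff (hθ : IsGeneral θ a b) (S : Vertex i j) (L : Facet i j) :
    configPoint θ S ∈ configLine θ L ↔ Incident S L := by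
  obtain ⟨hne, hT, hT'⟩ := L.exists_two_vertices.choose_spec.choose_spec
  rw [configLine, AffineSubspace.mem_mk', Submodule.mem_span_singleton, vsub_eq_sub]
  set T := L.exists_two_vertices.choose
  set T' := L.exists_two_vertices.choose_spec.choose
  constructor
  · rintro ⟨t, ht⟩
    by_contra hS
    -- `T` and `T'` share the labels of `L`, one of which is missing from `S`, so general position
    -- forbids collinearity.
    refine hθ.collinearity_ne S T T' hne (fun h => hS ((Finset.subset_inter hT hT').trans h)) ?_
    have hd := hθ.vertexDet_ne
    have ha := congrFun ht a
    have hb := congrFun ht b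
    simp only [Pi.sub_apply, Pi.smul_apply, smul_eq_mul] at ha hb
    rw [collinearity, separation_eq (hd S) (hd T), separation_eq (hd S) (hd T'),
      separation_eq (hd S) (hd T), separation_eq (hd S) (hd T'), eq_add_of_sub_eq ha.symm,
      eq_add_of_sub_eq hb.symm]
    ring
  · intro hS
    obtain ⟨t, ht⟩ := hθ.exists_smul_configPoint_sub hne hS hT hT'
    exact ⟨t, ht.symm⟩

/-- The realisation determined by parameters in general position. -/
noncomputable def realisation (hθ : IsGeneral θ a b) : Realisation K i j M where
  point := configPoint θ
  line := configLine θ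
  isAffineLine := hθ.isAffineLine_configLine
  mem_of_incident S L := (hθ.configPoint_mem_configLine_iff S L).2

theorem isFaithful_realisation (hθ : IsGeneral θ a b) (hi : 1 ≤ i) :
    hθ.realisation.IsFaithful where
  point_injective := hθ.configPoint_injective
  line_injective L L' h := by
    by_contra hne
    obtain ⟨S, hS, hS'⟩ := Facet.exists_incident_not_incident hi hne
    have h : configLine θ L = configLine θ L' := h
    rw [← hθ.configPoint_mem_configLine_iff] at hS hS'
    exact hS' (h ▸ hS)
  mem_iff := hθ.configPoint_mem_configLine_iff

theorem extends_realisation (hθ : IsGeneral θ a b) : hθ.realisation.Extends θ :=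
  ⟨hθ.configPoint_baseVertex, hθ.configPoint_arrayVertex⟩

theorem realisation_line_baseFacet (hθ : IsGeneral θ a b) (n : Fin (j + 1)) :
    hθ.realisation.line (baseFacet i n) = initialLine θ n := by
  have h0 := hθ.configPoint_baseVertex
  have h1 := hθ.configPoint_arrayVertex 0 n
  have hne := hθ.configPoint_injective.ne (baseVertex_ne_arrayVertex (0 : Fin (i + 1)) n)
  have hsub : (initialPoints θ).y 0 n =
      (initialPoints θ).y0 + θ (.coef 0 n) • fun a => θ (.dir n a) := rfl
  refine (hθ.isAffineLine_configLine _).eq_of_mem (isAffineLine_mk'_span_singleton _ ?_) hne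
    ((hθ.configPoint_mem_configLine_iff _ _).2 (incident_baseVertex n))
    ((hθ.configPoint_mem_configLine_iff _ _).2 (incident_arrayVertex 0 n)) ?_ ?_
  · intro hd
    rw [h0, h1, hsub, hd, smul_zero, add_zero] at hne
    exact hne rfl
  · rw [h0]
    exact AffineSubspace.self_mem_mk' _ _
  · rw [h1, hsub, initialLine, AffineSubspace.mem_mk', vsub_eq_sub, add_sub_cancel_left]
    exact Submodule.smul_mem _ _ (Submodule.mem_span_singleton_self _)

end IsGeneral

/-- Affine space is a partial linear space, and propagation needs injectivity only for `R`; hence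
`R'` may be degenerate. -/
theorem Realisation.IsFaithful.eq_of_extends {R R' : Realisation K i j M} (hR : R.IsFaithful)
    {θ : DataVar i j M → K} (h : R.Extends θ) (h' : R'.Extends θ) : R' = R := by
  obtain ⟨hp, hl⟩ := config_maps_agree (fun p l => IsAffineLine l ∧ p ∈ l)
    (fun p q l l' hpq h1 h2 h3 h4 => h1.1.eq_of_mem h3.1 hpq h1.2 h2.2 h3.2 h4.2)
    hR.point_injective hR.line_injective
    (fun S L hS => ⟨R.isAffineLine L, R.mem_of_incident S L hS⟩)
    (fun S L hS => ⟨R'.isAffineLine L, R'.mem_of_incident S L hS⟩)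
    (h'.1.trans h.1.symm) (fun m n => (h'.2 m n).trans (h.2 m n).symm)
  exact Realisation.ext hp hl

end Realisation

/-! ### Menelaus' theorem and the action of the generators -/

section Action

variable {i j M : ℕ} {K : Type*} [Field K]

/-- Menelaus' theorem, in one coordinate, for a quadrilateral whose points on three of the lines
are given by weights. -/
theorem multiRatio_eq_one_iff_of_weights {α β δ ab ac ad bc bd cd : K} (hβ : β ≠ 0)
    (hδ : δ ≠ 0) (had : β * (ab - ad) = α * (ac - ad)) (hbd : δ * (ab - bd) = α * (bc - bd))
    (hcd : δ * (ac - cd) = β * (bc - cd)) (hbc : ab ≠ bc) (hac : ab ≠ ac) (hbd' : bd ≠ bc)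
    (hadbd : bd ≠ ad) (hadcd : ad ≠ cd) (hacad : ad ≠ ac) (z : K) :
    multiRatio ab bc ad ac bd z = 1 ↔ z = cd := by
  -- The weights describe the line d cutting the triangle of a, b, c. The multi-ratio is Menelaus
  -- for the line c cutting the triangle of a, b, d, so the division ratios are rewritten with that
  -- triangle's vertices as endpoints.
  have h1 : (β - α) * (ad - ac) = β * (ab - ac) := by linear_combination -had
  have h2 : (δ - α) * (bd - bc) = δ * (ab - bc) := by linear_combination -hbd
  have hβα : β - α ≠ 0 := fun h => by
    rw [h, zero_mul] at h1
    exact mul_ne_zero hβ (sub_ne_zero.2 hac) h1.symm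
  have hδα : δ - α ≠ 0 := fun h => by
    rw [h, zero_mul] at h2
    exact mul_ne_zero hδ (sub_ne_zero.2 hbc) h2.symm
  have h3 : β * (δ - α) * (bd - cd) = δ * (β - α) * (ad - cd) := by
    linear_combination β * (-hbd) - δ * (-had) + α * hcd
  have key : (ab - bc) * (ad - ac) * (bd - cd) = (ab - ac) * (bd - bc) * (ad - cd) := by
    refine mul_left_cancel₀ (mul_ne_zero hβα hδα) ?_
    linear_combination (δ - α) * (ab - bc) * (bd - cd) * h1 -
      (β - α) * (ab - ac) * (ad - cd) * h2 + (ab - bc) * (ab - ac) * h3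
  have hA : (ab - bc) * (ad - ac) ≠ 0 := mul_ne_zero (sub_ne_zero.2 hbc) (sub_ne_zero.2 hacad)
  have hB : (ab - ac) * (bd - bc) ≠ 0 := mul_ne_zero (sub_ne_zero.2 hac) (sub_ne_zero.2 hbd')
  -- The cleared equation is linear in `z`; this is its leading coefficient up to sign, whence
  -- uniqueness.
  have hAB : (ab - bc) * (ad - ac) ≠ (ab - ac) * (bd - bc) := fun h => by
    rw [h] at key
    exact hadbd (sub_left_injective (mul_left_cancel₀ hB key))
  rw [multiRatio]
  constructor
  · intro h
    have h' := eq_of_div_eq_one h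
    refine sub_eq_zero.1 (mul_left_cancel₀ (sub_ne_zero.2 hAB) ?_)
    linear_combination key - h'
  · rintro rfl
    rw [key, div_self (mul_ne_zero hB (sub_ne_zero.2 hadcd))]

/-- The six vertices that contain two of the four labels `a`, `b`, `c`, `d` and all labels in `s`
satisfy the multi-ratio equation in each coordinate. -/
theorem IsGeneral.multiRatio_eq_one_iff {θ : DataVar i j M → K} {a₀ b₀ : Fin M}
    (hθ : IsGeneral θ a₀ b₀) {s : Finset (Label i j)} {a b c d : Label i j}
    (hab : a ≠ b) (hac : a ≠ c) (had : a ≠ d) (hbc : b ≠ c) (hbd : b ≠ d) (hcd : c ≠ d)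
    (has : a ∉ s) (hbs : b ∉ s) (hds : d ∉ s) {Sab Sac Sad Sbc Sbd Scd : Vertex i j}
    (eab : ∀ e, e ∈ Sab.1 ↔ e = a ∨ e = b ∨ e ∈ s) (eac : ∀ e, e ∈ Sac.1 ↔ e = a ∨ e = c ∨ e ∈ s)
    (ead : ∀ e, e ∈ Sad.1 ↔ e = a ∨ e = d ∨ e ∈ s) (ebc : ∀ e, e ∈ Sbc.1 ↔ e = b ∨ e = c ∨ e ∈ s)
    (ebd : ∀ e, e ∈ Sbd.1 ↔ e = b ∨ e = d ∨ e ∈ s) (ecd : ∀ e, e ∈ Scd.1 ↔ e = c ∨ e = d ∨ e ∈ s)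
    (k : Fin M) (z : K) :
    multiRatio (configPoint θ Sab k) (configPoint θ Sbc k) (configPoint θ Sad k)
      (configPoint θ Sac k) (configPoint θ Sbd k) z = 1 ↔ z = configPoint θ Scd k := by
  have ne : ∀ {S T : Vertex i j} (e : Label i j), e ∈ S.1 → e ∉ T.1 → S ≠ T :=
    fun e hS hT h => hT (h ▸ hS)
  have nab : d ∉ Sab.1 := by rw [eab]; tauto
  have nac : d ∉ Sac.1 := by rw [eac]; tauto
  have nbc : d ∉ Sbc.1 := by rw [ebc]; tauto
  have dad : d ∈ Sad.1 := by rw [ead]; tauto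
  have dbd : d ∈ Sbd.1 := by rw [ebd]; tauto
  have dcd : d ∈ Scd.1 := by rw [ecd]; tauto
  have ad_ab : ∀ e ∈ Sad.1, e ≠ d → e ∈ Sab.1 := fun e => by rw [ead, eab]; tauto
  have ad_ac : ∀ e ∈ Sad.1, e ≠ d → e ∈ Sac.1 := fun e => by rw [ead, eac]; tauto
  have bd_ab : ∀ e ∈ Sbd.1, e ≠ d → e ∈ Sab.1 := fun e => by rw [ebd, eab]; tauto
  have bd_bc : ∀ e ∈ Sbd.1, e ≠ d → e ∈ Sbc.1 := fun e => by rw [ebd, ebc]; tauto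
  have cd_ac : ∀ e ∈ Scd.1, e ≠ d → e ∈ Sac.1 := fun e => by rw [ecd, eac]; tauto
  have cd_bc : ∀ e ∈ Scd.1, e ≠ d → e ∈ Sbc.1 := fun e => by rw [ecd, ebc]; tauto
  have hdet := hθ.vertexDet_ne
  have sep : ∀ {S T : Vertex i j}, S ≠ T → configPoint θ S k ≠ configPoint θ T k :=
    fun h => hθ.configPoint_apply_ne h k
  exact multiRatio_eq_one_iff_of_weights
    (hθ.gap_ne_zero (ne d dad nac) ad_ac)
    (hθ.gap_ne_zero (ne d dbd nbc) bd_bc)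
    (gap_mul_configPoint_sub hdet ad_ab ad_ac k) (gap_mul_configPoint_sub hdet bd_ab bd_bc k)
    (gap_mul_configPoint_sub hdet cd_ac cd_bc k)
    (sep (ne a ((eab a).2 (.inl rfl)) (by rw [ebc]; tauto)))
    (sep (ne b ((eab b).2 (.inr (.inl rfl))) (by rw [eac]; tauto)))
    (sep (ne d dbd nbc))
    (sep (ne b ((ebd b).2 (.inl rfl)) (by rw [ead]; tauto)))
    (sep (ne a ((ead a).2 (.inl rfl)) (by rw [ecd]; tauto)))
    (sep (ne d dad nac)) z

/-- A generator moves positions in the array, so its permutation is composed with `σ` on the right.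
-/
theorem IsGeneral.acts_image {θ : DataVar i j M → K} {a₀ b₀ : Fin M}
    (hθ : IsGeneral θ a₀ b₀) (σ : Equiv.Perm (Label i j)) (g : Gen i j) (k : Fin M) :
    g.Acts ((hθ.realisation.image (Symmetry.ofPerm σ)).coord k)
      ((hθ.realisation.image (Symmetry.ofPerm (σ * g.perm))).coord k) := by
  have point_eq : ∀ S T : Vertex i j, permSubsets g.perm (j + 1) S = T →
      hθ.realisation.point ((Symmetry.ofPerm (σ * g.perm)).onVertex S) k =
        hθ.realisation.point ((Symmetry.ofPerm σ).onVertex T) k := by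
    rintro S _ rfl
    exact congrArg (hθ.realisation.point · k) (permSubsets_mul σ g.perm (j + 1) S)
  rcases g with m | n | _
  · refine ⟨point_eq _ _ (permSubsets_eq_iff.2 fun e he => ?_),
      fun p q => point_eq _ _ (permSubsets_eq_iff.2 fun e he => ?_)⟩
    · obtain ⟨n, rfl⟩ := mem_baseVertex.1 he
      exact mem_baseVertex.2 ⟨n, Equiv.swap_apply_of_ne_of_ne Sum.inl_ne_inr Sum.inl_ne_inr⟩
    · rw [mem_arrayVertex]
      rcases mem_arrayVertex.1 he with rfl | ⟨n, hn, rfl⟩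
      · exact .inl (Sum.inr_injective.map_swap _ _ _).symm
      · exact .inr ⟨n, hn, Equiv.swap_apply_of_ne_of_ne Sum.inl_ne_inr Sum.inl_ne_inr⟩
  · refine ⟨point_eq _ _ (permSubsets_eq_iff.2 fun e he => ?_),
      fun p q => point_eq _ _ (permSubsets_eq_iff.2 fun e he => ?_)⟩
    · obtain ⟨q, rfl⟩ := mem_baseVertex.1 he
      exact mem_baseVertex.2 ⟨_, (Sum.inl_injective.map_swap _ _ _).symm⟩
    · rw [mem_arrayVertex]
      rcases mem_arrayVertex.1 he with rfl | ⟨r, hr, rfl⟩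
      · exact .inl (Equiv.swap_apply_of_ne_of_ne Sum.inr_ne_inl Sum.inr_ne_inl)
      · exact .inr ⟨_, (Equiv.injective _).ne hr, (Sum.inl_injective.map_swap _ _ _).symm⟩
  · have swap_inl : ∀ n : Fin (j + 1), n ≠ 0 →
        (Gen.r0 : Gen i j).perm (Sum.inl n) = Sum.inl n := fun n hn =>
      Equiv.swap_apply_of_ne_of_ne (Sum.inl_injective.ne hn) Sum.inl_ne_inr
    have swap_inr : ∀ m : Fin (i + 1), m ≠ 0 →
        (Gen.r0 : Gen i j).perm (Sum.inr m) = Sum.inr m := fun m hm =>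
      Equiv.swap_apply_of_ne_of_ne Sum.inr_ne_inl (Sum.inr_injective.ne hm)
    have swap_inl_zero : (Gen.r0 : Gen i j).perm (Sum.inl 0) = Sum.inr 0 :=
      Equiv.swap_apply_left _ _
    have swap_inr_zero : (Gen.r0 : Gen i j).perm (Sum.inr 0) = Sum.inl 0 :=
      Equiv.swap_apply_right _ _
    refine ⟨point_eq _ _ (permSubsets_eq_iff.2 fun e he => ?_),
      point_eq _ _ (permSubsets_eq_iff.2 fun e he => ?_),
      fun m hm => point_eq _ _ (permSubsets_eq_iff.2 fun e he => ?_),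
      fun n hn => point_eq _ _ (permSubsets_eq_iff.2 fun e he => ?_), fun m n hm hn z => ?_⟩
    · rw [mem_arrayVertex]
      obtain ⟨n, rfl⟩ := mem_baseVertex.1 he
      by_cases hn : n = 0
      · exact .inl (hn ▸ swap_inl_zero)
      · exact .inr ⟨n, hn, swap_inl n hn⟩
    · rw [mem_baseVertex]
      rcases mem_arrayVertex.1 he with rfl | ⟨n, hn, rfl⟩
      · exact ⟨0, swap_inr_zero⟩
      · exact ⟨n, swap_inl n hn⟩
    · rw [mem_arrayVertex]
      rcases mem_arrayVertex.1 he with rfl | ⟨n, hn, rfl⟩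
      · exact .inl (swap_inr m hm)
      · exact .inr ⟨n, hn, swap_inl n hn⟩
    · rw [mem_arrayVertex]
      rcases mem_arrayVertex.1 he with rfl | ⟨q, hq, rfl⟩
      · exact .inr ⟨0, hn.symm, swap_inr_zero⟩
      · by_cases hq0 : q = 0
        · exact .inl (hq0 ▸ swap_inl_zero)
        · exact .inr ⟨q, hq, swap_inl q hq0⟩
    · have smem : ∀ e, σ e ∈ ((((baseVertex i j).1.erase (.inl 0)).erase (.inl n)).map
          σ.toEmbedding) ↔ ∃ q, q ≠ 0 ∧ q ≠ n ∧ e = Sum.inl q := by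
        intro e
        rw [Finset.mem_map_equiv, Equiv.symm_apply_apply, Finset.mem_erase, Finset.mem_erase,
          mem_baseVertex]
        constructor
        · rintro ⟨h1, h2, q, rfl⟩
          exact ⟨q, fun h => h2 (h ▸ rfl), fun h => h1 (h ▸ rfl), rfl⟩
        · rintro ⟨q, h1, h2, rfl⟩
          exact ⟨Sum.inl_injective.ne h2, Sum.inl_injective.ne h1, q, rfl⟩
      -- The six vertices share the image of the base labels other than `inl 0` and `inl n`, and
      -- each adds two of the remaining four labels.
      refine hθ.multiRatio_eq_one_iff (a := σ (.inl 0)) (b := σ (.inl n)) (c := σ (.inr m))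
        (d := σ (.inr 0)) (σ.injective.ne (Sum.inl_injective.ne hn.symm))
        (σ.injective.ne Sum.inl_ne_inr) (σ.injective.ne Sum.inl_ne_inr)
        (σ.injective.ne Sum.inl_ne_inr) (σ.injective.ne Sum.inl_ne_inr)
        (σ.injective.ne (Sum.inr_injective.ne hm))
        (s := (((baseVertex i j).1.erase (.inl 0)).erase (.inl n)).map σ.toEmbedding)
        (by rw [smem]; simp) (by rw [smem]; simp) (by rw [smem]; simp)
        ?_ ?_ ?_ ?_ ?_ ?_ k z
      all_goals
        intro e
        obtain ⟨e, rfl⟩ := σ.surjective e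
        rw [smem]
        simp only [Symmetry.ofPerm, mem_permSubsets, mem_baseVertex, mem_arrayVertex,
          σ.injective.eq_iff, permSubsets_mul]
      iterate 5
        · rcases e with q | p
          · simp only [Sum.inl.injEq, reduceCtorEq, false_or, exists_eq', exists_eq_right',
              exists_eq_right_right']
            grind only
          · simp [eq_comm]
      -- The sixth vertex, the new entry, is an image under `σ * r0` rather than `σ`, so its labels
      -- are first pulled back along `r0`.
      obtain ⟨e, rfl⟩ := (Gen.r0 : Gen i j).perm.surjective e
      rw [mem_permSubsets, mem_arrayVertex]
      rcases e with q | p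
      · by_cases hq0 : q = 0
        · subst hq0
          simp [swap_inl_zero, hn.symm]
        · simp [swap_inl q hq0, hq0, eq_comm]
      · by_cases hp0 : p = 0
        · subst hp0
          simp [swap_inr_zero, hm.symm]
        · simp [swap_inr p hp0, hp0]

theorem IsGeneral.diagonalActs_image {θ : DataVar i j M → K} {a₀ b₀ : Fin M}
    (hθ : IsGeneral θ a₀ b₀) (w : List (Gen i j)) (σ : Equiv.Perm (Label i j)) :
    DiagonalActs w (hθ.realisation.image (Symmetry.ofPerm σ))
      (hθ.realisation.image (Symmetry.ofPerm (σ * (w.map Gen.perm).prod))) := by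
  induction w generalizing σ with
  | nil => rw [List.map_nil, List.prod_nil, mul_one]; rfl
  | cons g w ih =>
    refine ⟨_, hθ.acts_image σ g, ?_⟩
    rw [List.map_cons, List.prod_cons, ← mul_assoc]
    exact ih _

theorem IsGeneral.initialPoints_eq_image {θ : DataVar i j M → K} {a₀ b₀ : Fin M}
    (hθ : IsGeneral θ a₀ b₀) :
    initialPoints θ = hθ.realisation.image (Symmetry.ofPerm 1) := by
  have : ∀ S : Vertex i j, permSubsets 1 (j + 1) S = S := fun S =>
    permSubsets_eq_iff.2 fun e he => he
  obtain ⟨h0, h1⟩ := hθ.extends_realisation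
  simp only [Realisation.image, Symmetry.ofPerm, this, h0, h1]

end Action

/-! ### The main theorem -/

theorem proposition6p1 (i j M : ℕ) (hi : 1 ≤ i) (hj : 1 ≤ j) (hM : 2 ≤ M) :
    (∀ φ : Symmetry i j, ∃ w : List (Gen i j), wordSymmetry w = φ) ∧
    ∃ P : MvPolynomial (DataVar i j M) ℤ, ∀ (K : Type*) [Field K],
      MvPolynomial.map (Int.castRingHom K) P ≠ 0 ∧
      ∀ θ : DataVar i j M → K, MvPolynomial.aeval θ P ≠ 0 →
        ∃ R : Realisation K i j M,
          R.IsFaithful ∧ R.Extends θ ∧ (∀ n, R.line (baseFacet i n) = initialLine θ n) ∧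
          (∀ R' : Realisation K i j M, R'.Extends θ → R' = R) ∧
          ∀ w : List (Gen i j), DiagonalActs w (initialPoints θ) (R.image (wordSymmetry w)) := by
  constructor
  · intro φ
    obtain ⟨σ, rfl⟩ := Symmetry.exists_ofPerm hj φ
    obtain ⟨w, rfl⟩ := Gen.exists_prod_perm σ
    exact ⟨w, rfl⟩
  -- Two distinct coordinates, available since M ≥ 2, suffice to detect non-collinearity.
  obtain ⟨P, hP⟩ := exists_generalPosition i j M (a := ⟨0, by omega⟩) (b := ⟨1, by omega⟩) (by simp)
  refine ⟨P, fun K _ => ⟨(hP K).1, fun θ hθP => ?_⟩⟩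
  have hθ := (hP K).2 θ hθP
  refine ⟨hθ.realisation, hθ.isFaithful_realisation hi, hθ.extends_realisation,
    hθ.realisation_line_baseFacet,
    fun R' hR' => (hθ.isFaithful_realisation hi).eq_of_extends hθ.extends_realisation hR',
    fun w => ?_⟩
  have := hθ.diagonalActs_image w 1
  rwa [← hθ.initialPoints_eq_image, one_mul] at this
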